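/- Let $\mathcal A=(\Sigma,Q,I,F,\delta)$ be an $\varepsilon$-free NFA with a finite non-empty alphabet $\Sigma$ and $|Q|=n$ states. For $w\in\Sigma$ let $T^{(w)}\in\{0,1\}^{Q\times Q}$ be its transition matrix, $T^{(w)}_{p,q}=1\iff (p,w,q)\in\delta$. Over the Boolean semifield $\mathbb B=(\{0,1\},\vee,\wedge,0,1)$, let $\mathcal R(T)=\{Tx : x\in\mathbb B^{Q}\}$ be the range of a matrix $T$, and for $\mathcal J\subseteq\Sigma$ let $\mathcal S(\mathcal J)$ be the monoid generated by $\{T^{(w)} : w\in\mathcal J\}$ under Boolean matrix multiplication (including the identity). The subset complexity of $\mathcal A$ is $$\|\mathcal A\|=\min_{\mathcal J\subseteq\Sigma}\Bigl(1+\sum_{w\in\Sigma\setminus\mathcal J}|\mathcal R(T^{(w)})|\Bigr)\,|\mathcal S(\mathcal J)| .$$ For a 0/1 matrix $T$, let $\operatorname{rank}(T)$ be its rank over $\mathbb F_2$, and let $\mathcal G(T)$ be its precedence graph, the directed graph on $Q$ with an edge $p\to q$ whenever $T_{p,q}=1$. The cyclicity $c(\mathcal G)$ of a finite directed graph $\mathcal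 G$ is the least common multiple of the cyclicities of its maximal strongly connected components, where the cyclicity of a component is the greatest common divisor of the lengths of its cycles, and is $1$ if the component contains no cycle. Proposition (All-but-one). For every $0<\varepsilon<4$ there is a constant $C>0$, depending only on $\varepsilon$, such that for every such NFA $\mathcal A$ and every symbol $a\in\Sigma$, $$\|\mathcal A\|\;\le\; C\,|\Sigma|\,\bigl(c(\mathcal G(T^{(a)}))+n^2\bigr)\,\max_{b\in\Sigma\setminus\{a\}}2^{\operatorname{rank}(T^{(b)})^2/(4-\varepsilon)},$$ where the maximum is read as $1$ if $\Sigma=\{a\}$. Consequently, if $\operatorname{rank}(T^{(b)})\le r$ for all $b\in\Sigma\setminus\{a\}$, then the subset construction applied to $\mathcal A$ produces at most $$C\,2^{r^2/(4-\varepsilon)}\,|\Sigma|\,\bigl(c(\mathcal G(T^{(a)}))+n^2\bigr)$$ states, which for fixed $r$ is polynomial in $|\Sigma|$, $n$ and $c(\mathcal G(T^{(a)}))$. -/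

import Mathlib

noncomputable section

/-- The Boolean semifield `({0, 1}, ∨, ∧, 0, 1)`. (Mathlib's ring structure on `Bool` has
exclusive or as its addition, so a separate type is used.) -/
def BoolSemifield : Type := Bool

namespace BoolSemifield

instance : DecidableEq BoolSemifield := inferInstanceAs (DecidableEq Bool)

instance : Fintype BoolSemifield := inferInstanceAs (Fintype Bool)

instance : Zero BoolSemifield := ⟨false⟩

instance : One BoolSemifield := ⟨true⟩

instance : Add BoolSemifield := ⟨Bool.or⟩

instance : CommSemiring BoolSemifield where
  mul := Bool.and
  add_assoc := Bool.or_assoc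
  zero_add := Bool.false_or
  add_zero := Bool.or_false
  add_comm := Bool.or_comm
  mul_assoc := Bool.and_assoc
  one_mul := Bool.true_and
  mul_one := Bool.and_true
  mul_comm := Bool.and_comm
  zero_mul := Bool.false_and
  mul_zero := Bool.and_false
  left_distrib := Bool.and_or_distrib_left
  right_distrib := Bool.and_or_distrib_right
  nsmul := nsmulRec

end BoolSemifield

namespace Digraph

variable {V : Type*}

/-- `G.HasWalk u v k`: there is a directed walk of length `k` from `u` to `v`. -/
inductive HasWalk (G : Digraph V) : V → V → ℕ → Prop
  | nil (u : V) : HasWalk G u u 0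
  | cons {u v w : V} {k : ℕ} : G.Adj u v → HasWalk G v w k → HasWalk G u w (k + 1)

/-- The maximal strongly connected component containing `v`, as a set of vertices. -/
def strongComponent (G : Digraph V) (v : V) : Set V :=
  {u | (∃ k, G.HasWalk v u k) ∧ (∃ k, G.HasWalk u v k)}

/-- The lengths of the cycles (closed walks of positive length) through vertices of `C`.
If `C` is a strongly connected component, such a cycle stays inside `C`. -/
def cycleLengths (G : Digraph V) (C : Set V) : Set ℕ :=
  {k | 0 < k ∧ ∃ v ∈ C, G.HasWalk v v k}

open Classical in
/-- The cyclicity of a strongly connected component: the greatest common divisor of the lengths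
of its cycles. A component without cycles (one vertex, no loop) has cyclicity `1`. -/
def componentCyclicity (G : Digraph V) (C : Set V) : ℕ :=
  if (G.cycleLengths C).Nonempty then Nat.setGcd (G.cycleLengths C) else 1

open Classical in
/-- The cyclicity of a finite directed graph: the least common multiple of the cyclicities of
its maximal strongly connected components. -/
def cyclicity [Fintype V] (G : Digraph V) : ℕ :=
  (Finset.univ.image G.strongComponent).lcm G.componentCyclicity

end Digraph

namespace BoolMatrix

variable {σ : Type*}

/-- The precedence graph of a Boolean square matrix. -/
def precedenceGraph (A : Matrix σ σ BoolSemifield) : Digraph σ where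
  Adj p q := A p q = 1

/-- The number of elements of the range `{A x}` of a matrix over the Boolean semifield. -/
def rangeCard [Fintype σ] (A : Matrix σ σ BoolSemifield) : ℕ :=
  (Set.range (fun x : σ → BoolSemifield => A.mulVec x)).ncard

/-- The rank over the field with two elements of a matrix with entries `0` and `1`. -/
def rankF2 [Fintype σ] (A : Matrix σ σ BoolSemifield) : ℕ :=
  (A.map (fun x => if x = 1 then (1 : ZMod 2) else 0)).rank

end BoolMatrix

namespace NFA

variable {α σ : Type*}

open Classical in
/-- The Boolean transition matrix of the symbol `w`. -/
def transitionMatrix (M : NFA α σ) (w : α) : Matrix σ σ BoolSemifield :=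
  Matrix.of fun p q => if q ∈ M.step p w then 1 else 0

open Classical in
/-- The monoid generated, under Boolean matrix multiplication, by the transition matrices of
the symbols in `J`. -/
def transitionMonoid [Fintype σ] (M : NFA α σ) (J : Set α) :
    Submonoid (Matrix σ σ BoolSemifield) :=
  Submonoid.closure (M.transitionMatrix '' J)

open Classical in
/-- The subset complexity of an automaton: the minimum, over all sets `J` of symbols, of
`(1 + ∑_{w ∉ J} |range T^(w)|) * |transition monoid of J|`. -/
def subsetComplexity [Fintype α] [Fintype σ] (M : NFA α σ) : ℕ :=
  (Finset.univ : Finset (Finset α)).inf' Finset.univ_nonempty fun J =>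
    (1 + ∑ w ∈ Finset.univ \ J, BoolMatrix.rangeCard (M.transitionMatrix w)) *
      Nat.card (M.transitionMonoid (J : Set α))

/-- The number of states of the automaton produced by the subset construction, that is, the
number of sets of states reached from the set of initial states by reading some word. -/
def subsetAutomatonSize (M : NFA α σ) : ℕ :=
  (Set.range M.eval).ncard

open Classical in
/-- The maximum of `2 ^ (rank(T^(b))² / (4 - ε))` over the symbols `b ≠ a`. All these numbers are
at least `1` for `ε < 4`; the maximum over no symbols (`a` is the only symbol) is taken to be
`1`. -/
def maxRankFactor [Fintype α] [Fintype σ] (M : NFA α σ) (a : α) (ε : ℝ) : ℝ :=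
  (Finset.univ.erase a).fold max 1 fun b =>
    (2 : ℝ) ^ ((BoolMatrix.rankF2 (M.transitionMatrix b) : ℝ) ^ 2 / (4 - ε))

end NFA

end

/-!
The subset complexity is estimated by its term for `J = {a}`, namely
`(1 + ∑_{b ≠ a} |range T^(b)|) * |{powers of T^(a)}|`; the two factors are bounded separately.

*Ranges.* Let `T` be a 0/1 matrix of rank `r` over the field with two elements. An entry of the
Boolean product `T x` vanishes if and only if all columns selected by `x` vanish there, so `T x`
depends only on the span of these columns over that field (`rangeCard_le_card_submodule`). This is
a subspace of the column space, which has dimension `r`. Comparing bases with arbitrary families of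
vectors, there are at most `2 ^ (k * (r + 1 - k))` subspaces of dimension `k`, so
`2 ^ (r ^ 2 / 4 + O(r))` in all (`card_submodule_le_rpow`). Any exponent `r ^ 2 / (4 - ε)` absorbs
the linear term at the cost of a constant (`rangeCard_le_rangeConst_mul`).

*Powers.* Entries of `T ^ k` record the walks of length `k` in the precedence graph. A walk of
length at least `2 * n ^ 2` meets some vertex `w` twice within `n` steps, and so has a closed walk
of length `l ≤ n` at `w`. Modulo `l`, every multiple of the cyclicity `c` is the length of a closed
walk at `w` (`HasWalk.exists_closed_modEq`). Inserting such a walk, shortening the parts before and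
after `w` to length less than `n * l` without changing their residues modulo `l`, and padding with
the closed walk of length `l` gives walks of all lengths at least `2 * n ^ 2` that differ from the
original one by a multiple of `c` (`HasWalk.of_dvd_sub`). Hence `T ^ (k + c) = T ^ k` for
`k ≥ 2 * n ^ 2`, and there are at most `2 * n ^ 2 + c` powers.

The subset construction obeys a bound of the same shape (`subsetAutomatonSize_le`), with transposed
matrices, because a set of states is multiplied by transition matrices from the left as a row
vector; transposing does not change the rank.
-/

/-! ### Walk lengths and cyclicity -/

namespace Digraph

variable {V : Type*} {G : Digraph V}

theorem HasWalk.append {u v w : V} {k l : ℕ} (h : G.HasWalk u v k) (h' : G.HasWalk v w l) :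
    G.HasWalk u w (k + l) := by
  induction h with
  | nil => simpa using h'
  | cons hadj _ ih =>
    rw [Nat.add_right_comm]
    exact .cons hadj (ih h')

theorem HasWalk.iterate {w : V} {l : ℕ} (h : G.HasWalk w w l) (m : ℕ) :
    G.HasWalk w w (m * l) := by
  induction m with
  | zero => simpa using HasWalk.nil w
  | succ m ih =>
    rw [Nat.succ_mul]
    exact ih.append h

/-- A walk is listed by a sequence of vertices, any two of which are joined by the part of the
walk between them. -/
theorem HasWalk.exists_vertex_seq {u v : V} {k : ℕ} (h : G.HasWalk u v k) :
    ∃ f : ℕ → V, f 0 = u ∧ f k = v ∧ ∀ i j, i ≤ j → j ≤ k → G.HasWalk (f i) (f j) (j - i) := by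
  induction h with
  | nil u =>
    refine ⟨fun _ => u, rfl, rfl, fun i j hij hj => ?_⟩
    obtain rfl : j = 0 := by omega
    simpa using HasWalk.nil u
  | @cons u v w k hadj _ ih =>
    obtain ⟨f, h0, hk, hf⟩ := ih
    refine ⟨fun i => Nat.casesOn i u f, rfl, hk, fun i j hij hj => ?_⟩
    cases j with
    | zero =>
      obtain rfl : i = 0 := by omega
      exact .nil u
    | succ j =>
      cases i with
      | zero =>
        refine .cons hadj ?_
        simpa [h0] using hf 0 j (Nat.zero_le _) (by omega)
      | succ i =>
        rw [Nat.add_sub_add_right]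
        exact hf i j (by omega) (by omega)

theorem componentCyclicity_ne_zero (C : Set V) : G.componentCyclicity C ≠ 0 := by
  unfold componentCyclicity
  split_ifs with h
  · obtain ⟨t, ht⟩ := h
    intro h0
    have := Nat.setGcd_eq_zero_iff.mp h0 ht
    exact ht.1.ne' this
  · exact one_ne_zero

section Finite

variable [Fintype V]

/-- Cutting out closed pieces whose length is a multiple of `l` brings the length of a walk below
`|V| * l`: a longer walk meets some vertex twice at times congruent modulo `l`. -/
theorem HasWalk.exists_short_modEq {u v : V} {k l : ℕ} (hl : 0 < l) (h : G.HasWalk u v k) :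
    ∃ k' < Fintype.card V * l, k' ≡ k [MOD l] ∧ G.HasWalk u v k' := by
  induction k using Nat.strong_induction_on with
  | _ k ih =>
    rcases lt_or_ge k (Fintype.card V * l) with hk | hk
    · exact ⟨k, hk, rfl, h⟩
    obtain ⟨f, h0, hfk, hf⟩ := h.exists_vertex_seq
    obtain ⟨i, j, hij, he⟩ :=
      Fintype.exists_ne_map_eq_of_card_lt
        (fun i : Fin (Fintype.card V * l + 1) =>
          (f i, (⟨i % l, Nat.mod_lt _ hl⟩ : Fin l))) (by simp)
    wlog hlt : i < j generalizing i j
    · exact this j i hij.symm he.symm (lt_of_le_of_ne (not_lt.mp hlt) hij.symm)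
    obtain ⟨i, hi⟩ := i
    obtain ⟨j, hj⟩ := j
    simp only [Prod.mk.injEq, Fin.mk.injEq, Fin.mk_lt_mk] at he hlt
    have hw : G.HasWalk u v (i + (k - j)) := by
      have h1 := hf 0 i (Nat.zero_le _) (by omega)
      have h2 := hf j k (by omega) le_rfl
      rw [h0, Nat.sub_zero] at h1
      rw [hfk, ← he.1] at h2
      exact h1.append h2
    obtain ⟨k', hk', hmod, hw'⟩ := ih _ (by omega) hw
    refine ⟨k', hk', hmod.trans ?_, hw'⟩
    have : i + (k - j) ≡ j + (k - j) [MOD l] := Nat.ModEq.add_right _ he.2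
    rwa [Nat.add_sub_cancel' (by omega)] at this

/-- A walk of length at least `|V|` contains a closed walk of positive length at most `|V|`. -/
theorem HasWalk.exists_closed {u v : V} {k : ℕ} (h : G.HasWalk u v k)
    (hk : Fintype.card V ≤ k) :
    ∃ w i l j, 0 < l ∧ l ≤ Fintype.card V ∧ i + l + j = k ∧
      G.HasWalk u w i ∧ G.HasWalk w w l ∧ G.HasWalk w v j := by
  obtain ⟨f, h0, hfk, hf⟩ := h.exists_vertex_seq
  obtain ⟨i, j, hij, he⟩ :=
    Fintype.exists_ne_map_eq_of_card_lt
      (fun i : Fin (Fintype.card V + 1) => f i) (by simp)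
  wlog hlt : i < j generalizing i j
  · exact this j i hij.symm he.symm (lt_of_le_of_ne (not_lt.mp hlt) hij.symm)
  obtain ⟨i, hi⟩ := i
  obtain ⟨j, hj⟩ := j
  simp only [Fin.mk_lt_mk] at he hlt
  have h1 := hf 0 i (Nat.zero_le _) (by omega)
  have h2 := hf i j (by omega) (by omega)
  have h3 := hf j k (by omega) le_rfl
  rw [h0, Nat.sub_zero] at h1
  rw [← he] at h2 h3
  rw [hfk] at h3
  exact ⟨f i, i, j - i, k - j, by omega, by omega, by omega, h1, h2, h3⟩

theorem cyclicity_pos : 0 < G.cyclicity := by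
  classical
  rw [Nat.pos_iff_ne_zero, cyclicity, Ne, Finset.lcm_eq_zero_iff]
  rintro ⟨C, -, hC⟩
  exact componentCyclicity_ne_zero C hC

/-- Modulo the length of a given closed walk at `w`, every multiple of the cyclicity, also a
negative one, is the length of a closed walk at `w`: these residues form a subgroup, and it
contains the lengths of all cycles in the component of `w`. -/
theorem HasWalk.exists_closed_modEq {w : V} {l : ℕ} (hl : 0 < l) (hw : G.HasWalk w w l)
    {z : ℤ} (hz : (G.cyclicity : ℤ) ∣ z) :
    ∃ m : ℕ, G.HasWalk w w m ∧ (m : ℤ) ≡ z [ZMOD l] := by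
  classical
  set C := G.strongComponent w with hC
  have hwC : w ∈ C := ⟨⟨0, .nil w⟩, ⟨0, .nil w⟩⟩
  have hne : (G.cycleLengths C).Nonempty := ⟨l, hl, w, hwC, hw⟩
  have hdvd : Nat.setGcd (G.cycleLengths C) ∣ G.cyclicity := by
    have : G.componentCyclicity C ∣ G.cyclicity :=
      Finset.dvd_lcm (Finset.mem_image_of_mem _ (Finset.mem_univ w))
    rwa [componentCyclicity, if_pos hne] at this
  have hspan : z ∈ Ideal.span (((↑) : ℕ → ℤ) '' G.cycleLengths C) := by
    rw [← Nat.span_singleton_setGcd, Ideal.mem_span_singleton]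
    exact (Int.natCast_dvd_natCast.mpr hdvd).trans hz
  clear hz
  induction hspan using Submodule.span_induction with
  | mem x hx =>
    obtain ⟨t, ⟨-, v, ⟨⟨p, hp⟩, ⟨q, hq⟩⟩, ht⟩, rfl⟩ := hx
    -- The detour to `v` and back is taken `l` times, so that it does not count modulo `l`.
    refine ⟨p + t + q + (l - 1) * (p + q),
      ((hp.append ht).append hq).append ((hp.append hq).iterate _), ?_⟩
    have : p + t + q + (l - 1) * (p + q) = t + l * (p + q) := by
      obtain ⟨l, rfl⟩ := Nat.exists_eq_succ_of_ne_zero hl.ne'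
      simp only [Nat.succ_eq_add_one, Nat.add_sub_cancel]
      ring
    rw [this, Int.natCast_modEq_iff]
    simp [Nat.ModEq]
  | zero => exact ⟨0, .nil w, rfl⟩
  | add x y _ _ hx hy =>
    obtain ⟨m, hm, hmx⟩ := hx
    obtain ⟨m', hm', hmy⟩ := hy
    exact ⟨m + m', hm.append hm', by push_cast; exact hmx.add hmy⟩
  | smul c x _ hx =>
    obtain ⟨m, hm, hmx⟩ := hx
    have hl' : (l : ℤ) ≠ 0 := by exact_mod_cast hl.ne'
    refine ⟨(c % l).toNat * m, hm.iterate _, ?_⟩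
    push_cast
    rw [Int.toNat_of_nonneg (Int.emod_nonneg _ hl')]
    exact (Int.mod_modEq c l).mul hmx

/-- The lengths of long walks may be changed by any amount that the cyclicity divides: insert at a
repeated vertex a closed walk with the right residue modulo the length `l` of a short closed walk
there, shorten both halves modulo `l`, and pad with the short closed walk. -/
theorem HasWalk.of_dvd_sub {u v : V} {k k' : ℕ} (hk : 2 * Fintype.card V ^ 2 ≤ k)
    (hk' : 2 * Fintype.card V ^ 2 ≤ k') (hdvd : (G.cyclicity : ℤ) ∣ (k' : ℤ) - k)
    (h : G.HasWalk u v k) : G.HasWalk u v k' := by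
  have hpos : 0 < Fintype.card V := Fintype.card_pos_iff.mpr ⟨u⟩
  obtain ⟨w, i, l, j, hl, hln, hijk, hi, hw, hj⟩ := h.exists_closed (by nlinarith)
  obtain ⟨m, hm, hmod⟩ := hw.exists_closed_modEq hl hdvd
  obtain ⟨i', hi'lt, hi'mod, hi'⟩ := hi.exists_short_modEq hl
  obtain ⟨j', hj'lt, hj'mod, hj'⟩ := ((hw.append hm).append hj).exists_short_modEq hl
  have hle : i' + j' ≤ k' := by nlinarith
  have hcong : i' + j' ≡ k' [MOD l] := by
    refine (hi'mod.add hj'mod).trans ?_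
    rw [← Int.natCast_modEq_iff]
    have e : ((i + (l + m + j) : ℕ) : ℤ) = k + m := by rw [← hijk]; push_cast; ring
    rw [e]
    simpa using (Int.ModEq.refl (k : ℤ)).add hmod
  obtain ⟨s, hs⟩ := (Nat.modEq_iff_dvd' hle).mp hcong
  have := (hi'.append (hw.iterate s)).append hj'
  rwa [show i' + s * l + j' = k' by rw [mul_comm s l, ← hs]; omega] at this

end Finite

end Digraph

/-! ### Powers of Boolean matrices -/

namespace BoolSemifield

theorem add_eq_one_iff : ∀ a b : BoolSemifield, a + b = 1 ↔ a = 1 ∨ b = 1 := by decide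

theorem mul_eq_one_iff : ∀ a b : BoolSemifield, a * b = 1 ↔ a = 1 ∧ b = 1 := by decide

instance : Nontrivial BoolSemifield := ⟨0, 1, by decide⟩

theorem eq_of_eq_one_iff : ∀ {a b : BoolSemifield}, (a = 1 ↔ b = 1) → a = b := by decide

theorem sum_eq_one_iff {ι : Type*} (s : Finset ι) (f : ι → BoolSemifield) :
    ∑ i ∈ s, f i = 1 ↔ ∃ i ∈ s, f i = 1 := by
  classical
  induction s using Finset.induction_on with
  | empty => simp [zero_ne_one]
  | insert a s ha ih => rw [Finset.sum_insert ha, add_eq_one_iff, ih, Finset.exists_mem_insert]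

end BoolSemifield

namespace BoolMatrix

open BoolSemifield

section Powers

variable {σ : Type*} [Fintype σ] [DecidableEq σ] (A : Matrix σ σ BoolSemifield)

theorem pow_apply_eq_one_iff (k : ℕ) (p q : σ) :
    (A ^ k) p q = 1 ↔ (precedenceGraph A).HasWalk p q k := by
  induction k generalizing p with
  | zero =>
    rw [pow_zero, Matrix.one_apply]
    constructor
    · split_ifs with h
      · exact fun _ => h ▸ .nil p
      · exact False.elim
    · rintro ⟨⟩
      simp
  | succ k ih =>
    rw [pow_succ', Matrix.mul_apply, sum_eq_one_iff]
    constructor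
    · rintro ⟨j, -, hj⟩
      rw [mul_eq_one_iff, ih] at hj
      exact .cons hj.1 hj.2
    · rintro (_ | ⟨hadj, hw⟩)
      exact ⟨_, Finset.mem_univ _, (mul_eq_one_iff _ _).mpr ⟨hadj, (ih _).mpr hw⟩⟩

/-- The powers of a Boolean matrix are periodic from `2 * n ^ 2` on, with the cyclicity of the
precedence graph as a period. -/
theorem pow_add_cyclicity {k : ℕ} (hk : 2 * Fintype.card σ ^ 2 ≤ k) :
    A ^ (k + (precedenceGraph A).cyclicity) = A ^ k := by
  ext p q
  refine eq_of_eq_one_iff ?_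
  rw [pow_apply_eq_one_iff, pow_apply_eq_one_iff]
  exact ⟨.of_dvd_sub (by omega) hk (by simp), .of_dvd_sub hk (by omega) (by simp)⟩

theorem exists_pow_eq (k : ℕ) :
    ∃ m < 2 * Fintype.card σ ^ 2 + (precedenceGraph A).cyclicity, A ^ m = A ^ k := by
  have hpos : 0 < (precedenceGraph A).cyclicity := Digraph.cyclicity_pos
  induction k using Nat.strong_induction_on with
  | _ k ih =>
    rcases lt_or_ge k (2 * Fintype.card σ ^ 2 + (precedenceGraph A).cyclicity) with hk | hk
    · exact ⟨k, hk, rfl⟩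
    obtain ⟨m, hm, he⟩ := ih (k - (precedenceGraph A).cyclicity) (by omega)
    refine ⟨m, hm, he.trans ?_⟩
    rw [← pow_add_cyclicity A (by omega), Nat.sub_add_cancel (by omega)]

theorem card_closure_singleton_le :
    Nat.card (Submonoid.closure {A}) ≤
      2 * Fintype.card σ ^ 2 + (precedenceGraph A).cyclicity := by
  set N := 2 * Fintype.card σ ^ 2 + (precedenceGraph A).cyclicity
  have hsurj : Function.Surjective (fun m : Fin N =>
      (⟨A ^ (m : ℕ), Submonoid.mem_closure_singleton.mpr ⟨m, rfl⟩⟩ : Submonoid.closure {A})) := by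
    rintro ⟨B, hB⟩
    obtain ⟨k, rfl⟩ := Submonoid.mem_closure_singleton.mp hB
    obtain ⟨m, hm, he⟩ := exists_pow_eq A k
    exact ⟨⟨m, hm⟩, Subtype.ext he⟩
  simpa using Nat.card_le_card_of_surjective _ hsurj

end Powers

end BoolMatrix

/-! ### The number of subspaces over the field with two elements -/

section Subspaces

variable {V : Type*} [AddCommGroup V] [Module (ZMod 2) V] [Finite V]

/-- Each of the subspaces of dimension `k` has at least `2 ^ (k * (k - 1))` bases, and there are at
most `2 ^ (n * k)` families of `k` vectors. -/
theorem card_subspaces_of_finrank_le {k : ℕ} (hk : k ≤ Module.finrank (ZMod 2) V) :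
    Nat.card {W : Submodule (ZMod 2) V // Module.finrank (ZMod 2) W = k} ≤
      2 ^ (k * (Module.finrank (ZMod 2) V + 1 - k)) := by
  classical
  have := Fintype.ofFinite V
  set n := Module.finrank (ZMod 2) V with hn
  let S := {W : Submodule (ZMod 2) V // Module.finrank (ZMod 2) W = k}
  let bases : S → Type _ := fun W => {s : Fin k → W.1 // LinearIndependent (ZMod 2) s}
  let ι : (Σ W, bases W) → (Fin k → V) := fun x i => (x.2.1 i : V)
  have hspan : ∀ x : Σ W, bases W, Submodule.span (ZMod 2) (Set.range (ι x)) = x.1.1 := by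
    rintro ⟨⟨W, hW⟩, ⟨s, hs⟩⟩
    have h := hs.span_eq_top_of_card_eq_finrank' (by simp [hW])
    have h2 : Set.range (ι ⟨⟨W, hW⟩, ⟨s, hs⟩⟩) = W.subtype '' Set.range s := by
      rw [← Set.range_comp]; rfl
    rw [h2, ← Submodule.map_span, h, Submodule.map_top, Submodule.range_subtype]
  have hinj : Function.Injective ι := by
    intro x y hxy
    have h1 : x.1 = y.1 := Subtype.ext (by rw [← hspan x, ← hspan y, hxy])
    obtain ⟨W, s, hs⟩ := x
    obtain ⟨W', s', hs'⟩ := y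
    obtain rfl : W = W' := h1
    have : s = s' := funext fun i => Subtype.ext (congrFun hxy i)
    subst this
    rfl
  have hcard : ∀ W : S, 2 ^ (k * (k - 1)) ≤ Nat.card (bases W) := by
    rintro ⟨W, hW⟩
    have := card_linearIndependent (K := ZMod 2) (V := W) (k := k) hW.ge
    change 2 ^ (k * (k - 1)) ≤ Nat.card {s : Fin k → W // LinearIndependent (ZMod 2) s}
    rw [this, hW, ZMod.card]
    calc 2 ^ (k * (k - 1)) = ∏ _i : Fin k, 2 ^ (k - 1) := by
          rw [Finset.prod_const, Finset.card_univ, Fintype.card_fin, ← pow_mul, mul_comm]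
      _ ≤ _ := Finset.prod_le_prod' fun i _ => by
          have h1 : 2 ^ (i : ℕ) ≤ 2 ^ (k - 1) := Nat.pow_le_pow_right two_pos (by omega)
          have h2 : 2 ^ k = 2 * 2 ^ (k - 1) := by
            rw [← pow_succ', Nat.sub_add_cancel i.pos]
          omega
  have htot : Nat.card S * 2 ^ (k * (k - 1)) ≤ 2 ^ (n * k) := by
    have h1 : Nat.card (Σ W, bases W) ≤ 2 ^ (n * k) := by
      refine (Nat.card_le_card_of_injective ι hinj).trans ?_
      rw [Nat.card_fun, Nat.card_eq_fintype_card (α := V), Module.card_eq_pow_finrank (K := ZMod 2),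
        ZMod.card, Nat.card_fin, ← pow_mul]
    refine le_trans ?_ h1
    have : Fintype S := Fintype.ofFinite S
    rw [Nat.card_sigma, Nat.card_eq_fintype_card, ← smul_eq_mul, ← Finset.card_univ]
    exact Finset.card_nsmul_le_sum _ _ _ fun W _ => hcard W
  refine Nat.le_of_mul_le_mul_right (htot.trans_eq ?_) (Nat.pow_pos (n := k * (k - 1)) two_pos)
  rw [← pow_add]
  congr 1
  obtain ⟨d, hd⟩ := Nat.exists_eq_add_of_le hk
  rw [hd]
  cases k with
  | zero => simp
  | succ k =>
    rw [show k + 1 + d + 1 - (k + 1) = d + 1 by omega, Nat.add_sub_cancel]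
    ring

theorem card_submodule_le_sum :
    Nat.card (Submodule (ZMod 2) V) ≤ ∑ k ∈ Finset.range (Module.finrank (ZMod 2) V + 1),
      2 ^ (k * (Module.finrank (ZMod 2) V + 1 - k)) := by
  classical
  have := Fintype.ofFinite (Submodule (ZMod 2) V)
  have hmaps : ∀ W ∈ (Finset.univ : Finset (Submodule (ZMod 2) V)),
      Module.finrank (ZMod 2) W ∈ Finset.range (Module.finrank (ZMod 2) V + 1) := fun W _ =>
    Finset.mem_range.mpr (Nat.lt_succ_of_le W.finrank_le)
  rw [Nat.card_eq_fintype_card, ← Finset.card_univ, Finset.card_eq_sum_card_fiberwise hmaps]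
  refine Finset.sum_le_sum fun k hk => ?_
  refine le_trans (le_of_eq ?_)
    (card_subspaces_of_finrank_le (Nat.lt_succ_iff.mp (Finset.mem_range.mp hk)))
  rw [Nat.card_eq_fintype_card, Fintype.card_subtype]

/-- The exponent `k * (n + 1 - k)` is at most `(n + 1) ^ 2 / 4`, which is `n ^ 2 / 4` up to a linear
term. -/
theorem card_submodule_le_rpow :
    (Nat.card (Submodule (ZMod 2) V) : ℝ) ≤
      2 ^ ((Module.finrank (ZMod 2) V : ℝ) ^ 2 / 4 + 3 / 2 * Module.finrank (ZMod 2) V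
        + 1 / 4) := by
  set n := Module.finrank (ZMod 2) V
  have h1 : (Nat.card (Submodule (ZMod 2) V) : ℝ) ≤
      ∑ k ∈ Finset.range (n + 1), (2 : ℝ) ^ (k * (n + 1 - k)) := by
    exact_mod_cast card_submodule_le_sum (V := V)
  have h2 : ∀ k ∈ Finset.range (n + 1),
      (2 : ℝ) ^ (k * (n + 1 - k)) ≤ 2 ^ (((n : ℝ) + 1) ^ 2 / 4) := by
    intro k hk
    rw [← Real.rpow_natCast]
    refine Real.rpow_le_rpow_of_exponent_le one_le_two ?_
    push_cast [Nat.cast_sub (Finset.mem_range.mp hk).le]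
    nlinarith [sq_nonneg ((n : ℝ) + 1 - 2 * k)]
  have h3 : ((n : ℝ) + 1) ≤ 2 ^ (n : ℝ) := by
    rw [Real.rpow_natCast]
    exact_mod_cast Nat.lt_two_pow_self (n := n)
  calc (Nat.card (Submodule (ZMod 2) V) : ℝ)
      ≤ ∑ _k ∈ Finset.range (n + 1), (2 : ℝ) ^ (((n : ℝ) + 1) ^ 2 / 4) :=
        h1.trans (Finset.sum_le_sum h2)
    _ = ((n : ℝ) + 1) * 2 ^ (((n : ℝ) + 1) ^ 2 / 4) := by simp
    _ ≤ 2 ^ (n : ℝ) * 2 ^ (((n : ℝ) + 1) ^ 2 / 4) := by gcongr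
    _ = _ := by
        rw [← Real.rpow_add two_pos]
        congr 1
        ring

end Subspaces

/-! ### Ranges of Boolean matrices -/

namespace BoolMatrix

open BoolSemifield

section Range

variable {σ : Type*} [Fintype σ] (A : Matrix σ σ BoolSemifield)

theorem rankF2_transpose : rankF2 A.transpose = rankF2 A := by
  rw [rankF2, rankF2, Matrix.transpose_map, Matrix.rank_transpose]

/-- Over the Boolean semifield, the entry `i` of `A x` vanishes if and only if all columns of `A`
selected by `x` vanish at `i`, and hence, reading `A` over the field with two elements, if and only
if the span of these columns does. So `A x` depends only on this subspace of the column space. -/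
theorem rangeCard_le_card_submodule :
    rangeCard A ≤ Nat.card (Submodule (ZMod 2) (LinearMap.range
      (A.map (fun x => if x = 1 then (1 : ZMod 2) else 0)).mulVecLin)) := by
  classical
  set B : Matrix σ σ (ZMod 2) := A.map (fun x => if x = 1 then (1 : ZMod 2) else 0) with hB
  let col : σ → LinearMap.range B.mulVecLin := fun j => B.mulVecLin.rangeRestrict (Pi.single j 1)
  have hcol : ∀ i j, (col j : σ → ZMod 2) i = B i j := fun i j => by simp [col]
  let W : (σ → BoolSemifield) → Submodule (ZMod 2) (LinearMap.range B.mulVecLin) :=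
    fun x => Submodule.span (ZMod 2) (col '' {j | x j = 1})
  have hW : ∀ x i, A.mulVec x i = 1 ↔
      ¬ W x ≤ LinearMap.ker (LinearMap.proj i ∘ₗ (LinearMap.range B.mulVecLin).subtype) := by
    intro x i
    rw [Submodule.span_le, Matrix.mulVec, dotProduct, sum_eq_one_iff, Set.not_subset]
    constructor
    · rintro ⟨j, -, hj⟩
      rw [mul_eq_one_iff] at hj
      exact ⟨col j, ⟨j, hj.2, rfl⟩, by simp [hcol, hB, hj.1]⟩
    · rintro ⟨_, ⟨j, hj, rfl⟩, h⟩
      refine ⟨j, Finset.mem_univ _, (mul_eq_one_iff _ _).mpr ⟨?_, hj⟩⟩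
      by_contra hne
      exact h (by simp [hcol, hB, hne])
  have hfac : ∀ x y, W x = W y → A.mulVec x = A.mulVec y := fun x y h =>
    funext fun i => eq_of_eq_one_iff (by rw [hW, hW, h])
  refine Nat.card_le_card_of_injective
    (fun y : Set.range (fun x : σ → BoolSemifield => A.mulVec x) => W y.2.choose) fun y z h => ?_
  have := hfac _ _ h
  rw [Subtype.ext_iff, ← y.2.choose_spec, ← z.2.choose_spec]
  exact this

theorem rangeCard_le_rpow : (rangeCard A : ℝ) ≤
    2 ^ ((rankF2 A : ℝ) ^ 2 / 4 + 3 / 2 * rankF2 A + 1 / 4) :=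
  (Nat.cast_le.mpr (rangeCard_le_card_submodule A)).trans card_submodule_le_rpow

/-- A factor by which the linear term in the exponent of `rangeCard_le_rpow` is absorbed when
`rank ^ 2 / 4` is replaced by `rank ^ 2 / (4 - ε)`. -/
noncomputable def rangeConst (ε : ℝ) : ℝ := 2 ^ (9 / (16 * (1 / (4 - ε) - 1 / 4)) + 1 / 4)

theorem sub_one_div_four_pos {ε : ℝ} (hε : 0 < ε) (hε4 : ε < 4) : 0 < 1 / (4 - ε) - 1 / 4 :=
  sub_pos.mpr (one_div_lt_one_div_of_lt (by linarith) (by linarith))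

theorem one_le_rangeConst {ε : ℝ} (hε : 0 < ε) (hε4 : ε < 4) : 1 ≤ rangeConst ε := by
  have := sub_one_div_four_pos hε hε4
  exact Real.one_le_rpow one_le_two (by positivity)

theorem rangeCard_le_rangeConst_mul {ε : ℝ} (hε : 0 < ε) (hε4 : ε < 4) :
    (rangeCard A : ℝ) ≤ rangeConst ε * 2 ^ ((rankF2 A : ℝ) ^ 2 / (4 - ε)) := by
  refine (rangeCard_le_rpow A).trans ?_
  rw [rangeConst, ← Real.rpow_add two_pos]
  refine Real.rpow_le_rpow_of_exponent_le one_le_two ?_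
  have hδ := sub_one_div_four_pos hε hε4
  set δ := 1 / (4 - ε) - 1 / 4 with hδdef
  set t : ℝ := (rankF2 A : ℝ)
  have h1 : t ^ 2 / (4 - ε) = t ^ 2 / 4 + δ * t ^ 2 := by rw [hδdef]; ring
  -- The difference of the two sides is the square of `δ * t - 3 / 4`, divided by `δ`.
  have h2 : δ * t ^ 2 - 3 / 2 * t + 9 / (16 * δ) = (δ * t - 3 / 4) ^ 2 / δ := by
    field_simp
    ring
  have h3 : 0 ≤ (δ * t - 3 / 4) ^ 2 / δ := by positivity
  linarith

end Range

end BoolMatrix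

/-! ### Automata -/

namespace NFA

open BoolSemifield

variable {α σ : Type*}

/-- The image of a set of states under a Boolean matrix, read as a relation between states. -/
def relImage (S : Set σ) (A : Matrix σ σ BoolSemifield) : Set σ := {q | ∃ p ∈ S, A p q = 1}

theorem stepSet_eq_relImage (M : NFA α σ) (S : Set σ) (w : α) :
    M.stepSet S w = relImage S (M.transitionMatrix w) := by
  ext q
  simp [mem_stepSet, relImage, transitionMatrix, zero_ne_one]

theorem relImage_one [DecidableEq σ] (S : Set σ) : relImage S 1 = S := by
  ext q
  constructor
  · rintro ⟨p, hp, h⟩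
    rw [Matrix.one_apply] at h
    split_ifs at h with hpq
    exact hpq ▸ hp
  · exact fun hq => ⟨q, hq, Matrix.one_apply_eq q⟩

variable [Fintype σ]

theorem relImage_relImage (S : Set σ) (A B : Matrix σ σ BoolSemifield) :
    relImage (relImage S A) B = relImage S (A * B) := by
  ext q
  simp only [relImage, Set.mem_ofPred_eq, Matrix.mul_apply, sum_eq_one_iff, mul_eq_one_iff,
    Finset.mem_univ, true_and]
  constructor
  · rintro ⟨j, ⟨p, hp, h1⟩, h2⟩
    exact ⟨p, hp, j, h1, h2⟩
  · rintro ⟨p, hp, j, h1, h2⟩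
    exact ⟨j, ⟨p, hp, h1⟩, h2⟩

/-- Reading a symbol multiplies the set of states, as a row vector, by the transition matrix; this
is why the transposed matrix appears. -/
theorem ncard_range_relImage_le (A : Matrix σ σ BoolSemifield) :
    (Set.range fun S => relImage S A).ncard ≤ BoolMatrix.rangeCard A.transpose := by
  classical
  have hsub : (Set.range fun S => relImage S A) ⊆
      (fun y : σ → BoolSemifield => {q | y q = 1}) ''
        Set.range (fun x : σ → BoolSemifield => A.transpose.mulVec x) := by
    rintro _ ⟨S, rfl⟩
    refine ⟨_, ⟨fun p => if p ∈ S then 1 else 0, rfl⟩, ?_⟩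
    ext q
    simp [relImage, Matrix.mulVec, dotProduct, sum_eq_one_iff, ite_eq_iff]
  exact (Set.ncard_le_ncard hsub (Set.toFinite _)).trans (Set.ncard_image_le (Set.toFinite _))

/-- A word either is a power of `a` or ends with some `b ≠ a` followed by a power of `a`. So a set
of states that is reached is the image, under a power of the matrix of `a`, of the set of initial
states or of a set that is reached by reading some `b ≠ a`. -/
theorem subsetAutomatonSize_le [Fintype α] [DecidableEq α] [DecidableEq σ] (M : NFA α σ) (a : α) :
    M.subsetAutomatonSize ≤
      (1 + ∑ b ∈ Finset.univ.erase a,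
          BoolMatrix.rangeCard (M.transitionMatrix b).transpose) *
        Nat.card (Submonoid.closure {M.transitionMatrix a}) := by
  let R : α → Set (Set σ) := fun b => Set.range fun S => relImage S (M.transitionMatrix b)
  let P : Set (Set σ) := {M.start} ∪ ⋃ b ∈ Finset.univ.erase a, R b
  let N : Set (Matrix σ σ BoolSemifield) := Submonoid.closure {M.transitionMatrix a}
  have hN : N.Finite := by
    refine Set.Finite.subset (Set.finite_range fun m : Fin (2 * Fintype.card σ ^ 2 +
      (BoolMatrix.precedenceGraph (M.transitionMatrix a)).cyclicity) =>
        M.transitionMatrix a ^ (m : ℕ)) ?_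
    intro B hB
    obtain ⟨k, rfl⟩ := Submonoid.mem_closure_singleton.mp hB
    obtain ⟨m, hm, he⟩ := BoolMatrix.exists_pow_eq (M.transitionMatrix a) k
    exact ⟨⟨m, hm⟩, he⟩
  have hsub : Set.range M.eval ⊆ (fun x => relImage x.1 x.2) '' (P ×ˢ N) := by
    rintro _ ⟨w, rfl⟩
    induction w using List.reverseRecOn with
    | nil =>
      exact ⟨(M.start, 1), ⟨Or.inl rfl, one_mem (Submonoid.closure _)⟩, relImage_one _⟩
    | append_singleton w c ih =>
      rw [eval_append_singleton, stepSet_eq_relImage]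
      by_cases hc : c = a
      · subst hc
        obtain ⟨⟨S, B⟩, ⟨hS, hB⟩, he⟩ := ih
        refine ⟨(S, B * M.transitionMatrix c),
          ⟨hS, mul_mem (S := Submonoid _) hB (Submonoid.mem_closure_singleton_self)⟩, ?_⟩
        rw [← he, relImage_relImage]
      · refine ⟨(relImage (M.eval w) (M.transitionMatrix c), 1),
          ⟨Or.inr ?_, one_mem (Submonoid.closure _)⟩, relImage_one _⟩
        exact Set.mem_biUnion (Finset.mem_erase.mpr ⟨hc, Finset.mem_univ c⟩) ⟨_, rfl⟩
  have hP : P.ncard ≤ 1 + ∑ b ∈ Finset.univ.erase a,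
      BoolMatrix.rangeCard (M.transitionMatrix b).transpose := by
    refine (Set.ncard_union_le _ _).trans (Nat.add_le_add (Set.ncard_singleton _).le ?_)
    exact (Finset.set_ncard_biUnion_le _ _).trans
      (Finset.sum_le_sum fun b _ => ncard_range_relImage_le _)
  calc M.subsetAutomatonSize ≤ (P ×ˢ N).ncard :=
        (Set.ncard_le_ncard hsub ((P.toFinite.prod hN).image _)).trans
          (Set.ncard_image_le (P.toFinite.prod hN))
    _ = P.ncard * N.ncard := Set.ncard_prod
    _ ≤ _ := Nat.mul_le_mul hP le_rfl

theorem subsetComplexity_le [Fintype α] [DecidableEq α] [DecidableEq σ] (M : NFA α σ) (a : α) :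
    M.subsetComplexity ≤
      (1 + ∑ b ∈ Finset.univ.erase a, BoolMatrix.rangeCard (M.transitionMatrix b)) *
        Nat.card (Submonoid.closure {M.transitionMatrix a}) := by
  refine (Finset.inf'_le _ (Finset.mem_univ {a})).trans (le_of_eq ?_)
  rw [← Finset.sdiff_singleton_eq_erase, transitionMonoid, Finset.coe_singleton,
    Set.image_singleton]
  congr!

/-- The common estimate of both bounds: `f b` stands for the size of the range of the matrix of `b`
or of its transpose. -/
theorem one_add_sum_mul_card_closure_le [Fintype α] [DecidableEq α] [DecidableEq σ] (M : NFA α σ)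
    (a : α) (f : α → ℕ) {K X : ℝ} (hK : 1 ≤ K) (hX : 1 ≤ X)
    (hf : ∀ b, b ≠ a → (f b : ℝ) ≤ K * X) :
    (((1 + ∑ b ∈ Finset.univ.erase a, f b) *
        Nat.card (Submonoid.closure {M.transitionMatrix a}) : ℕ) : ℝ) ≤
      2 * K * ((Fintype.card α : ℝ) *
        (((BoolMatrix.precedenceGraph (M.transitionMatrix a)).cyclicity : ℝ) +
          (Fintype.card σ : ℝ) ^ 2) * X) := by
  have h1 : (1 + ∑ b ∈ Finset.univ.erase a, (f b : ℝ)) ≤ (Fintype.card α : ℝ) * (K * X) := by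
    have hs : ∑ b ∈ Finset.univ.erase a, (f b : ℝ) ≤ ∑ b ∈ Finset.univ.erase a, K * X :=
      Finset.sum_le_sum fun b hb => hf b (Finset.ne_of_mem_erase hb)
    have ht := Finset.add_sum_erase Finset.univ (fun _ : α => K * X) (Finset.mem_univ a)
    rw [Finset.sum_const (s := Finset.univ), Finset.card_univ, nsmul_eq_mul] at ht
    have : 1 ≤ K * X := one_le_mul_of_one_le_of_one_le hK hX
    linarith
  have h2 : (Nat.card (Submonoid.closure {M.transitionMatrix a}) : ℝ) ≤
      2 * (((BoolMatrix.precedenceGraph (M.transitionMatrix a)).cyclicity : ℝ) +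
        (Fintype.card σ : ℝ) ^ 2) := by
    have h : (Nat.card (Submonoid.closure {M.transitionMatrix a}) : ℝ) ≤
        2 * (Fintype.card σ : ℝ) ^ 2 +
          ((BoolMatrix.precedenceGraph (M.transitionMatrix a)).cyclicity : ℝ) := by
      exact_mod_cast BoolMatrix.card_closure_singleton_le (M.transitionMatrix a)
    have : (0 : ℝ) ≤ ((BoolMatrix.precedenceGraph (M.transitionMatrix a)).cyclicity : ℝ) :=
      Nat.cast_nonneg _
    linarith
  push_cast
  refine (mul_le_mul h1 h2 (Nat.cast_nonneg _) (by positivity)).trans_eq ?_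
  ring

theorem one_le_maxRankFactor [Fintype α] (M : NFA α σ) (a : α) (ε : ℝ) :
    1 ≤ M.maxRankFactor a ε :=
  Finset.le_fold_max _ |>.mpr (Or.inl le_rfl)

theorem le_maxRankFactor [Fintype α] (M : NFA α σ) {a b : α} (hb : b ≠ a) (ε : ℝ) :
    (2 : ℝ) ^ ((BoolMatrix.rankF2 (M.transitionMatrix b) : ℝ) ^ 2 / (4 - ε)) ≤
      M.maxRankFactor a ε :=
  Finset.le_fold_max _ |>.mpr
    (Or.inr ⟨b, by simp [hb], le_rfl⟩)

end NFA

theorem mainTheorem4 (ε : ℝ) (hε : 0 < ε) (hε4 : ε < 4) :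
    ∃ C : ℝ, 0 < C ∧
      ∀ (α : Type*) (σ : Type*) [Fintype α] [Fintype σ] (M : NFA α σ) (a : α),
        (M.subsetComplexity : ℝ) ≤
            C * ((Fintype.card α : ℝ) *
              (((BoolMatrix.precedenceGraph (M.transitionMatrix a)).cyclicity : ℝ) +
                (Fintype.card σ : ℝ) ^ 2) * M.maxRankFactor a ε) ∧
        ∀ r : ℕ, (∀ b : α, b ≠ a → BoolMatrix.rankF2 (M.transitionMatrix b) ≤ r) →
          (M.subsetAutomatonSize : ℝ) ≤
            C * ((Fintype.card α : ℝ) *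
              (((BoolMatrix.precedenceGraph (M.transitionMatrix a)).cyclicity : ℝ) +
                (Fintype.card σ : ℝ) ^ 2) * (2 : ℝ) ^ ((r : ℝ) ^ 2 / (4 - ε))) := by
  classical
  have hK := BoolMatrix.one_le_rangeConst hε hε4
  have h4 : 0 < 4 - ε := by linarith
  refine ⟨2 * BoolMatrix.rangeConst ε, by positivity, fun α σ _ _ M a => ⟨?_, fun r hr => ?_⟩⟩
  · refine (Nat.cast_le.mpr (M.subsetComplexity_le a)).trans
      (M.one_add_sum_mul_card_closure_le a _ hK (M.one_le_maxRankFactor a ε) fun b hb => ?_)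
    refine (BoolMatrix.rangeCard_le_rangeConst_mul _ hε hε4).trans ?_
    gcongr
    exact M.le_maxRankFactor hb ε
  · refine (Nat.cast_le.mpr (M.subsetAutomatonSize_le a)).trans
      (M.one_add_sum_mul_card_closure_le a _ hK
        (Real.one_le_rpow one_le_two (by positivity)) fun b hb => ?_)
    refine (BoolMatrix.rangeCard_le_rangeConst_mul _ hε hε4).trans ?_
    rw [BoolMatrix.rankF2_transpose]
    gcongr
    · exact one_le_two
    · exact hr b hb
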